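/- For $u\in\mathbb Z^2$ and $\rho\ge 0$ let $B_\rho(u)=\{v\in\mathbb Z^2 : d(u,v)\le \rho\}$, where $d$ is the Euclidean distance, and for $r>0$, $\Delta\ge 0$ let $$S_{r,\Delta}(u,v)=\bigl(B_r(u)\setminus B_{r+\Delta}(v)\bigr)\cup\bigl(B_r(v)\setminus B_{r+\Delta}(u)\bigr).$$ A set $C\subseteq\mathbb Z^2$ is an $(r,\Delta)$-identifying code if $B_r(u)\cap C\ne\emptyset$ for every $u\in\mathbb Z^2$ and $S_{r,\Delta}(u,v)\cap C\neq\emptyset$ for all distinct $u,v\in\mathbb Z^2$. Its density is $D(C)=\limsup_{n\to\infty}|C\cap Q_n|/|Q_n|$ with $Q_n=\{(x,y)\in\mathbb Z^2: |x|\le n,\ |y|\le n\}$. An $(r,\Delta)$-identifying code is optimal if no $(r,\Delta)$-identifying code has lower density. Let $k$ and $i$ be two integers such that $i$ is odd and $i^2<2k+1$. Let $r=\sqrt{k^2+i^2}$ and let $\Delta$ be defined by $r+\Delta=\sqrt{r^2+2k}$. Then the horizontal pattern $S_{r,\Delta}((0,0),(-1,0))$ has exactly $4$ elements, and it meets all the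 diagonal lines modulo $4$, that is, for every $j\in\{0,1,2,3\}$ it contains a point $(x,y)$ with $y-x\equiv j \pmod 4$. Moreover, there is an absolute constant $r_0$ such that, for all such $k$ and $i$ with $r\ge r_0$, there is an optimal $(r,\Delta)$-identifying code of density $\frac14$. -/

import Mathlib

namespace TolerantCode

noncomputable section

/-- The Euclidean distance between two vertices of the integer lattice, taken in the plane. -/
def latticeDist (u v : ℤ × ℤ) : ℝ :=
  dist (!₂[(u.1 : ℝ), (u.2 : ℝ)] : EuclideanSpace ℝ (Fin 2)) !₂[(v.1 : ℝ), (v.2 : ℝ)]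

/-- The ball `B_r(u)` of lattice points at Euclidean distance at most `r` from `u`. -/
def ball (r : ℝ) (u : ℤ × ℤ) : Set (ℤ × ℤ) := {v | latticeDist u v ≤ r}

/-- For a nonnegative radius the ball is given by the usual quadratic inequality. -/
theorem mem_ball_iff {r : ℝ} (hr : 0 ≤ r) (u v : ℤ × ℤ) :
    v ∈ ball r u ↔ ((v.1 : ℝ) - u.1) ^ 2 + ((v.2 : ℝ) - u.2) ^ 2 ≤ r ^ 2 := by
  have h : latticeDist u v = √(((u.1 : ℝ) - v.1) ^ 2 + ((u.2 : ℝ) - v.2) ^ 2) := by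
    simp [latticeDist, EuclideanSpace.dist_eq, Real.dist_eq, sq_abs]
  rw [ball, Set.mem_ofPred_eq, h, Real.sqrt_le_left hr, sub_sq_comm (u.1 : ℝ),
    sub_sq_comm (u.2 : ℝ)]

/-- The set `S_{r,Δ}(u,v)` of vertices that separate `u` from `v` with tolerance `Δ`. -/
def separatingSet (r Δ : ℝ) (u v : ℤ × ℤ) : Set (ℤ × ℤ) :=
  (ball r u \ ball (r + Δ) v) ∪ (ball r v \ ball (r + Δ) u)

/-- The horizontal pattern `S_{r,Δ}((0,0),(-1,0))`. -/
def horizontalPattern (r Δ : ℝ) : Set (ℤ × ℤ) := separatingSet r Δ (0, 0) (-1, 0)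

/-- `C` is an `(r,Δ)`-tolerant identifying code. -/
def IsIdentifyingCode (r Δ : ℝ) (C : Set (ℤ × ℤ)) : Prop :=
  (∀ u, (ball r u ∩ C).Nonempty) ∧ ∀ u v, u ≠ v → (separatingSet r Δ u v ∩ C).Nonempty

/-- The square `Q_n = {(x,y) : |x| ≤ n, |y| ≤ n}`. -/
def square (n : ℕ) : Set (ℤ × ℤ) := {p | |p.1| ≤ (n : ℤ) ∧ |p.2| ≤ (n : ℤ)}

/-- The density `D(C) = limsup |C ∩ Q_n| / |Q_n|`. -/
def density (C : Set (ℤ × ℤ)) : ℝ :=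
  Filter.limsup (fun n : ℕ => ((C ∩ square n).ncard : ℝ) / ((square n).ncard : ℝ)) Filter.atTop

/-- `C` is an `(r,Δ)`-identifying code and no `(r,Δ)`-identifying code has lower density. -/
def IsOptimalIdentifyingCode (r Δ : ℝ) (C : Set (ℤ × ℤ)) : Prop :=
  IsIdentifyingCode r Δ C ∧ ∀ C', IsIdentifyingCode r Δ C' → density C ≤ density C'

/-- `U` meets all the diagonal lines modulo `m`. -/
def MeetsAllDiagonals (m : ℕ) (U : Set (ℤ × ℤ)) : Prop :=
  ∀ j : ℤ, 0 ≤ j → j < m → ∃ p ∈ U, p.2 - p.1 ≡ j [ZMOD m]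

end

end TolerantCode

namespace TolerantCode

/-! ### Integer form of balls and separating sets -/

/-! Both squared radii are integers, so everything reduces to integer inequalities. The horizontal
pattern is `{(k, ±i), (-1 - k, ±i)}`; since `i` is odd, the sign of `i` shifts `y - x` by 2 modulo 4
and the side changes its parity, so all four residues occur.

Lower bound: a code meets every translate of this 4-point pattern, so its density is at least 1/4
(`one_fourth_le_density`). Upper bound: the diagonals `y ≡ x` modulo 4 have density 1/4, and they
form a code once every separating set meets every residue class. For unit difference vectors the
pattern and its symmetric copies suffice. Any other vector reduces by symmetry to `0 ≤ b ≤ a`, where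
a point of the crescent between the balls around `(0, 0)` and `(-1, -1)` works; for large `k` this
crescent is thick enough to prescribe residues (`exists_crescent_point`). -/

theorem mem_ball_iff_int {ρ : ℝ} (hρ : 0 ≤ ρ) {T : ℤ} (hT : ρ ^ 2 = T) (u v : ℤ × ℤ) :
    v ∈ ball ρ u ↔ (v.1 - u.1) ^ 2 + (v.2 - u.2) ^ 2 ≤ T := by
  rw [mem_ball_iff hρ, hT]
  exact_mod_cast Iff.rfl

theorem mem_separatingSet_iff_int {r Δ : ℝ} {R T : ℤ} (hr : 0 ≤ r) (hrΔ : 0 ≤ r + Δ)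
    (hR : r ^ 2 = R) (hT : (r + Δ) ^ 2 = T) (u v p : ℤ × ℤ) :
    p ∈ separatingSet r Δ u v ↔
      ((p.1 - u.1) ^ 2 + (p.2 - u.2) ^ 2 ≤ R ∧ T < (p.1 - v.1) ^ 2 + (p.2 - v.2) ^ 2) ∨
      ((p.1 - v.1) ^ 2 + (p.2 - v.2) ^ 2 ≤ R ∧ T < (p.1 - u.1) ^ 2 + (p.2 - u.2) ^ 2) := by
  simp only [separatingSet, Set.mem_union, Set.mem_sdiff, mem_ball_iff_int hr hR,
    mem_ball_iff_int hrΔ hT, not_le]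

theorem one_le_of_odd_of_sq_lt {k i : ℤ} (hi : Odd i) (hik : i ^ 2 < 2 * k + 1) : 1 ≤ k := by
  have h0 : i ≠ 0 := by rintro rfl; simp at hi
  have : 0 < i ^ 2 := by positivity
  linarith

theorem radius_sq {k i : ℤ} {r : ℝ} (hr : r = √((k : ℝ) ^ 2 + (i : ℝ) ^ 2)) :
    0 ≤ r ∧ r ^ 2 = ((k ^ 2 + i ^ 2 : ℤ) : ℝ) := by
  subst hr
  refine ⟨Real.sqrt_nonneg _, ?_⟩
  rw [Real.sq_sqrt (by positivity)]
  push_cast; ring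

theorem outer_radius_sq {k i : ℤ} {r Δ : ℝ} (hk : 1 ≤ k)
    (hr : r = √((k : ℝ) ^ 2 + (i : ℝ) ^ 2)) (hΔ : r + Δ = √(r ^ 2 + 2 * (k : ℝ))) :
    0 ≤ r + Δ ∧ (r + Δ) ^ 2 = ((k ^ 2 + i ^ 2 + 2 * k : ℤ) : ℝ) := by
  have hk' : (1 : ℝ) ≤ k := by exact_mod_cast hk
  rw [hΔ]
  refine ⟨Real.sqrt_nonneg _, ?_⟩
  rw [Real.sq_sqrt (by positivity), (radius_sq hr).2]
  push_cast; ring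

theorem mem_separatingSet_iff {k i : ℤ} {r Δ : ℝ} (hk : 1 ≤ k)
    (hr : r = √((k : ℝ) ^ 2 + (i : ℝ) ^ 2)) (hΔ : r + Δ = √(r ^ 2 + 2 * (k : ℝ)))
    (u v p : ℤ × ℤ) :
    p ∈ separatingSet r Δ u v ↔
      ((p.1 - u.1) ^ 2 + (p.2 - u.2) ^ 2 ≤ k ^ 2 + i ^ 2 ∧
        k ^ 2 + i ^ 2 + 2 * k < (p.1 - v.1) ^ 2 + (p.2 - v.2) ^ 2) ∨
      ((p.1 - v.1) ^ 2 + (p.2 - v.2) ^ 2 ≤ k ^ 2 + i ^ 2 ∧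
        k ^ 2 + i ^ 2 + 2 * k < (p.1 - u.1) ^ 2 + (p.2 - u.2) ^ 2) :=
  mem_separatingSet_iff_int (radius_sq hr).1 (outer_radius_sq hk hr hΔ).1 (radius_sq hr).2
    (outer_radius_sq hk hr hΔ).2 u v p

/-! ### The horizontal pattern -/

/-- Subtracting the inequalities gives `x ≥ k`, while `x ≥ k + 1` would force `i ^ 2 ≥ 2 * k + 1`.
At `x = k` they squeeze `y ^ 2` to `i ^ 2`. -/
theorem eq_of_mem_crescent {k i x y : ℤ} (hk : 1 ≤ k) (hik : i ^ 2 < 2 * k + 1)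
    (h₁ : x ^ 2 + y ^ 2 ≤ k ^ 2 + i ^ 2) (h₂ : k ^ 2 + i ^ 2 + 2 * k < (x + 1) ^ 2 + y ^ 2) :
    x = k ∧ (y = i ∨ y = -i) := by
  have hx : k ≤ x := by linarith
  have hxk : x = k := by
    by_contra hne
    have : k + 1 ≤ x := by omega
    nlinarith [sq_nonneg y]
  subst hxk
  refine ⟨rfl, sq_eq_sq_iff_eq_or_eq_neg.mp ?_⟩
  linarith

/-- The four points of the horizontal pattern. -/
def patternPoints (k i : ℤ) : Finset (ℤ × ℤ) := {(k, i), (k, -i), (-1 - k, i), (-1 - k, -i)}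

theorem horizontalPattern_eq {k i : ℤ} {r Δ : ℝ} (hi : Odd i) (hik : i ^ 2 < 2 * k + 1)
    (hr : r = √((k : ℝ) ^ 2 + (i : ℝ) ^ 2)) (hΔ : r + Δ = √(r ^ 2 + 2 * (k : ℝ))) :
    horizontalPattern r Δ = patternPoints k i := by
  have hk := one_le_of_odd_of_sq_lt hi hik
  ext ⟨x, y⟩
  rw [horizontalPattern, mem_separatingSet_iff hk hr hΔ]
  simp only [patternPoints, Finset.coe_insert, Finset.coe_singleton, Set.mem_insert_iff,
    Set.mem_singleton_iff, Prod.mk.injEq, sub_zero, sub_neg_eq_add]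
  constructor
  · rintro (⟨h₁, h₂⟩ | ⟨h₁, h₂⟩)
    · have := eq_of_mem_crescent hk hik h₁ h₂
      tauto
    · have := eq_of_mem_crescent (x := -1 - x) (y := y) hk hik (by linarith) (by linarith)
      grind
  · rintro (⟨rfl, rfl⟩ | ⟨rfl, rfl⟩ | ⟨rfl, rfl⟩ | ⟨rfl, rfl⟩)
    · left; constructor <;> linarith
    · left; constructor <;> linarith
    · right; constructor <;> linarith
    · right; constructor <;> linarith

theorem card_patternPoints {k i : ℤ} (hi : Odd i) (hk : 1 ≤ k) :
    (patternPoints k i).card = 4 := by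
  obtain ⟨a, rfl⟩ := hi
  have h₁ : k ≠ -1 - k := by omega
  have h₂ : 2 * a + 1 ≠ -(2 * a + 1) := by omega
  rw [patternPoints, Finset.card_insert_of_notMem, Finset.card_insert_of_notMem,
    Finset.card_insert_of_notMem, Finset.card_singleton] <;>
  simp only [Finset.mem_insert, Finset.mem_singleton, Prod.mk.injEq] <;> omega

theorem ncard_horizontalPattern {k i : ℤ} {r Δ : ℝ} (hi : Odd i) (hik : i ^ 2 < 2 * k + 1)
    (hr : r = √((k : ℝ) ^ 2 + (i : ℝ) ^ 2)) (hΔ : r + Δ = √(r ^ 2 + 2 * (k : ℝ))) :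
    (horizontalPattern r Δ).ncard = 4 := by
  rw [horizontalPattern_eq hi hik hr hΔ, Set.ncard_coe_finset,
    card_patternPoints hi (one_le_of_odd_of_sq_lt hi hik)]

theorem exists_patternPoints_dvd {k i : ℤ} (hi : Odd i) (j : ℤ) :
    ∃ p ∈ patternPoints k i, 4 ∣ p.2 - p.1 - j := by
  obtain ⟨a, rfl⟩ := hi
  simp only [patternPoints, Finset.mem_insert, Finset.mem_singleton, exists_eq_or_imp,
    exists_eq_left]
  omega

theorem meetsAllDiagonals_horizontalPattern {k i : ℤ} {r Δ : ℝ} (hi : Odd i)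
    (hik : i ^ 2 < 2 * k + 1) (hr : r = √((k : ℝ) ^ 2 + (i : ℝ) ^ 2))
    (hΔ : r + Δ = √(r ^ 2 + 2 * (k : ℝ))) :
    MeetsAllDiagonals 4 (horizontalPattern r Δ) := by
  rw [horizontalPattern_eq hi hik hr hΔ]
  intro j _ _
  obtain ⟨p, hp, h⟩ := exists_patternPoints_dvd (k := k) hi j
  exact ⟨p, hp, (Int.modEq_iff_dvd.mpr (by exact_mod_cast h)).symm⟩

/-! ### Every separating set meets every diagonal modulo four -/

theorem exists_sub_mod_four (n c : ℤ) : ∃ m, n - 3 ≤ m ∧ m ≤ n ∧ 4 ∣ m - c :=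
  ⟨n - (n - c) % 4, by omega, by omega, by omega⟩

theorem exists_int_sqrt {n : ℤ} (hn : 0 ≤ n) : ∃ s : ℤ, 0 ≤ s ∧ s ^ 2 ≤ n ∧ n < (s + 1) ^ 2 := by
  refine ⟨Int.sqrt n, Int.sqrt_nonneg n, ?_, ?_⟩
  · lift n to ℕ using hn
    rw [Int.sqrt_natCast]
    exact_mod_cast Nat.sqrt_le' n
  · lift n to ℕ using hn
    rw [Int.sqrt_natCast]
    exact_mod_cast Nat.lt_succ_sqrt' n

/-- The difference of the balls of squared radii `R` and `R + 2k` around two diagonal neighbours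
has points with prescribed `x + y` and `x - y` modulo `4`. -/
theorem exists_crescent_point {k R : ℤ} (hk : 1000 ≤ k) (h₁ : k ^ 2 ≤ R)
    (h₂ : R ≤ k ^ 2 + 2 * k) (j : ℤ) :
    ∃ x y : ℤ, 0 ≤ y ∧ y ≤ x ∧ x ^ 2 + y ^ 2 ≤ R ∧
      R + 2 * k < (x + 1) ^ 2 + (y + 1) ^ 2 ∧ 4 ∣ x + y - j ∧ 4 ∣ x - y - j := by
  -- With `m = x + y` and `d = x - y` the target is `m ^ 2 + d ^ 2 ≤ 2 * R` and `2 * R + 4 * k < (m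
  -- + 2) ^ 2 + d ^ 2`, where `s ≈ √2 * k`.
  obtain ⟨s, hs0, hs1, hs2⟩ := exists_int_sqrt (n := 2 * R) (by nlinarith)
  have hslow : 7 * k < 5 * (s + 1) := by
    by_contra! h
    have := pow_le_pow_left₀ (by linarith) h 2
    have := sq_nonneg k
    linarith
  have hsup : 2 * s ≤ 3 * k := by
    by_contra! h
    have := pow_le_pow_left₀ (by linarith) h.le 2
    have := mul_nonneg (show 0 ≤ k by linarith) (sub_nonneg.mpr hk)
    linarith
  -- Starting from `s - 1` rather than `s` keeps `2 * R - m ^ 2` large, so that `D ≥ 3` and `d ≥ 0`.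
  obtain ⟨m, hm1, hm2, hm⟩ := exists_sub_mod_four (s - 1) j
  have hm3 : m ^ 2 ≤ (s - 1) ^ 2 := pow_le_pow_left₀ (by linarith) hm2 2
  have hm4 : (s - 4) ^ 2 ≤ m ^ 2 := pow_le_pow_left₀ (by linarith) (by linarith) 2
  have hU0 : 2 * s - 1 ≤ 2 * R - m ^ 2 := by linarith
  have hU1 : 2 * R - m ^ 2 ≤ 15 * k := by linarith
  obtain ⟨D, hD0, hD1, hD2⟩ := exists_int_sqrt (n := 2 * R - m ^ 2) (by linarith)
  have hDup : 5 * D ≤ k - 10 := by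
    by_contra! h
    have := pow_le_pow_left₀ (by linarith) h.le 2
    have := mul_nonneg (show 0 ≤ k by linarith) (sub_nonneg.mpr hk)
    linarith
  have hDlow : 3 ≤ D := by
    by_contra! h
    have := pow_le_pow_left₀ (by linarith) (show D + 1 ≤ 3 by linarith) 2
    linarith
  obtain ⟨d, hd1, hd2, hd⟩ := exists_sub_mod_four D j
  have hd3 : d ^ 2 ≤ D ^ 2 := pow_le_pow_left₀ (by linarith) hd2 2
  have hd4 : (D - 3) ^ 2 ≤ d ^ 2 := pow_le_pow_left₀ (by linarith) hd1 2
  have hdsq : d ^ 2 ≤ 2 * R - m ^ 2 := by linarith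
  -- Rounding `d` loses at most `8 * D - 9`, about `1.6 * k`; the gain `4 * m + 4`, about `5.6 * k`,
  -- covers this and `4 * k`.
  have hdsq' : 2 * R + 4 * k + 2 ≤ (m + 2) ^ 2 + d ^ 2 := by linarith
  obtain ⟨y, hy⟩ : ∃ y, m - d = 2 * y := ⟨(m - d) / 2, by omega⟩
  obtain rfl : m = d + 2 * y := by linarith
  refine ⟨d + y, y, by omega, by omega, by linarith, by linarith, ?_, ?_⟩
  · have : d + y + y - j = d + 2 * y - j := by ring
    rwa [this]
  · have : d + y - y - j = d - j := by ring
    rwa [this]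

/-- The conclusion for a difference vector `(a, b)` that is not a unit vector. -/
theorem exists_separating_of_le {k R a b : ℤ} (hk : 1000 ≤ k) (h₁ : k ^ 2 ≤ R)
    (h₂ : R ≤ k ^ 2 + 2 * k) (hab : |b| ≤ |a|) (hne : 1 ≤ |b| ∨ 2 ≤ |a|) (j : ℤ) :
    ∃ X Y : ℤ, X ^ 2 + Y ^ 2 ≤ R ∧ R + 2 * k < (X + a) ^ 2 + (Y + b) ^ 2 ∧ 4 ∣ Y - X - j := by
  -- The shift `(1, 1)` is the worst case: it is below `(a', b')` coordinatewise if `b' ≥ 1`, and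
  -- shifting by `(2, 0)` goes at least as far because `y ≤ x`.
  have aux (x y a' b' : ℤ) (hy : 0 ≤ y) (hyx : y ≤ x) (hb : 0 ≤ b') (hab : b' ≤ a')
      (hne : 1 ≤ b' ∨ 2 ≤ a') (h : R + 2 * k < (x + 1) ^ 2 + (y + 1) ^ 2) :
      R + 2 * k < (x + a') ^ 2 + (y + b') ^ 2 := by
    rcases hne with h' | h'
    · nlinarith
    · nlinarith
  rcases le_total 0 a with ha | ha <;> rcases le_total 0 b with hb | hb <;>
    simp only [abs_of_nonneg, abs_of_nonpos, ha, hb] at hab hne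
  -- Reflections turn `Y - X` into `±(x - y)` or `±(x + y)`, hence the control of both residues.
  · obtain ⟨x, y, hy, hyx, hR, hT, hc, hd⟩ := exists_crescent_point hk h₁ h₂ (-j)
    exact ⟨x, y, hR, aux x y a b hy hyx hb hab hne hT, by omega⟩
  · obtain ⟨x, y, hy, hyx, hR, hT, hc, hd⟩ := exists_crescent_point hk h₁ h₂ (-j)
    refine ⟨x, -y, by linarith, ?_, by omega⟩
    linarith [aux x y a (-b) hy hyx (by linarith) hab hne hT]
  · obtain ⟨x, y, hy, hyx, hR, hT, hc, hd⟩ := exists_crescent_point hk h₁ h₂ j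
    refine ⟨-x, y, by linarith, ?_, by omega⟩
    linarith [aux x y (-a) b hy hyx hb hab hne hT]
  · obtain ⟨x, y, hy, hyx, hR, hT, hc, hd⟩ := exists_crescent_point hk h₁ h₂ j
    refine ⟨-x, -y, by linarith, ?_, by omega⟩
    linarith [aux x y (-a) (-b) hy hyx (by linarith) hab hne hT]

theorem exists_separating_of_abs_le {k i a b : ℤ} (hk : 1000 ≤ k) (hi : Odd i)
    (hik : i ^ 2 < 2 * k + 1) (hab : |b| ≤ |a|) (ha : a ≠ 0) (j : ℤ) :
    ∃ X Y : ℤ, ((X ^ 2 + Y ^ 2 ≤ k ^ 2 + i ^ 2 ∧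
        k ^ 2 + i ^ 2 + 2 * k < (X + a) ^ 2 + (Y + b) ^ 2) ∨
      ((X + a) ^ 2 + (Y + b) ^ 2 ≤ k ^ 2 + i ^ 2 ∧ k ^ 2 + i ^ 2 + 2 * k < X ^ 2 + Y ^ 2)) ∧
      4 ∣ Y - X - j := by
  by_cases hne : 1 ≤ |b| ∨ 2 ≤ |a|
  · obtain ⟨X, Y, h₁, h₂, h₃⟩ := exists_separating_of_le (R := k ^ 2 + i ^ 2) hk
      (by nlinarith) (by linarith) hab hne j
    exact ⟨X, Y, Or.inl ⟨h₁, h₂⟩, h₃⟩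
  have hb : b = 0 := by
    have := abs_nonneg b
    exact abs_eq_zero.mp (by omega)
  have ha : a = 1 ∨ a = -1 := by
    have := abs_pos.mpr ha
    exact eq_or_eq_neg_of_abs_eq (by omega)
  subst hb
  obtain ⟨t, ht⟩ := hi
  rcases ha with rfl | rfl
  · obtain ⟨Y, hY, h | h⟩ : ∃ Y : ℤ, (Y = i ∨ Y = -i) ∧ (4 ∣ Y - k - j ∨ 4 ∣ Y - (-1 - k) - j) := by
      simp only [or_and_right, exists_or, exists_eq_left]
      omega
    · have hY : Y ^ 2 = i ^ 2 := sq_eq_sq_iff_eq_or_eq_neg.mpr hY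
      exact ⟨k, Y, Or.inl ⟨by linarith, by linarith⟩, h⟩
    · have hY : Y ^ 2 = i ^ 2 := sq_eq_sq_iff_eq_or_eq_neg.mpr hY
      exact ⟨-1 - k, Y, Or.inr ⟨by linarith, by linarith⟩, h⟩
  · obtain ⟨Y, hY, h | h⟩ : ∃ Y : ℤ, (Y = i ∨ Y = -i) ∧ (4 ∣ Y - (-k) - j ∨ 4 ∣ Y - (1 + k) - j) := by
      simp only [or_and_right, exists_or, exists_eq_left]
      omega
    · have hY : Y ^ 2 = i ^ 2 := sq_eq_sq_iff_eq_or_eq_neg.mpr hY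
      exact ⟨-k, Y, Or.inl ⟨by linarith, by linarith⟩, h⟩
    · have hY : Y ^ 2 = i ^ 2 := sq_eq_sq_iff_eq_or_eq_neg.mpr hY
      exact ⟨1 + k, Y, Or.inr ⟨by linarith, by linarith⟩, h⟩

theorem exists_separating {k i a b : ℤ} (hk : 1000 ≤ k) (hi : Odd i)
    (hik : i ^ 2 < 2 * k + 1) (hab : ¬(a = 0 ∧ b = 0)) (j : ℤ) :
    ∃ X Y : ℤ, ((X ^ 2 + Y ^ 2 ≤ k ^ 2 + i ^ 2 ∧
        k ^ 2 + i ^ 2 + 2 * k < (X + a) ^ 2 + (Y + b) ^ 2) ∨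
      ((X + a) ^ 2 + (Y + b) ^ 2 ≤ k ^ 2 + i ^ 2 ∧ k ^ 2 + i ^ 2 + 2 * k < X ^ 2 + Y ^ 2)) ∧
      4 ∣ Y - X - j := by
  rcases le_total |b| |a| with h | h
  · exact exists_separating_of_abs_le hk hi hik h (by rintro rfl; simp at h hab; exact hab h) j
  · obtain ⟨X, Y, h₁, h₂⟩ :=
      exists_separating_of_abs_le hk hi hik h (by rintro rfl; simp at h hab; exact hab h) (-j)
    refine ⟨Y, X, ?_, by omega⟩
    -- Swapping coordinates negates `Y - X`, which explains `-j` above.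
    simpa only [add_comm] using h₁

/-! ### The diagonal code -/

/-- Every fourth diagonal. -/
def diagonalCode : Set (ℤ × ℤ) := {p | 4 ∣ p.2 - p.1}

theorem isIdentifyingCode_diagonalCode {k i : ℤ} {r Δ : ℝ} (hk : 1000 ≤ k) (hi : Odd i)
    (hik : i ^ 2 < 2 * k + 1) (hr : r = √((k : ℝ) ^ 2 + (i : ℝ) ^ 2))
    (hΔ : r + Δ = √(r ^ 2 + 2 * (k : ℝ))) :
    IsIdentifyingCode r Δ diagonalCode := by
  constructor
  · intro u
    obtain ⟨m, hm1, hm2, hm⟩ := exists_sub_mod_four u.2 u.1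
    refine ⟨(u.1, m), ?_, hm⟩
    rw [mem_ball_iff_int (radius_sq hr).1 (radius_sq hr).2]
    simp only
    nlinarith
  · intro u v huv
    obtain ⟨X, Y, h, hd⟩ := exists_separating (a := u.1 - v.1) (b := u.2 - v.2) hk hi hik
      (by rintro ⟨h₁, h₂⟩; exact huv (Prod.ext (by omega) (by omega))) (u.1 - u.2)
    refine ⟨(u.1 + X, u.2 + Y), ?_, ?_⟩
    · rw [mem_separatingSet_iff (by omega) hr hΔ]
      simp only [add_sub_cancel_left]
      have e₁ : u.1 + X - v.1 = X + (u.1 - v.1) := by ring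
      have e₂ : u.2 + Y - v.2 = Y + (u.2 - v.2) := by ring
      rwa [e₁, e₂]
    · change 4 ∣ u.2 + Y - (u.1 + X)
      omega

/-! ### Densities -/

/-- The square `Q_n` as a finite set. -/
noncomputable def squareFinset (n : ℕ) : Finset (ℤ × ℤ) :=
  Finset.Icc (-(n : ℤ)) n ×ˢ Finset.Icc (-(n : ℤ)) n

theorem coe_squareFinset (n : ℕ) : (squareFinset n : Set (ℤ × ℤ)) = square n := by
  ext p
  simp only [squareFinset, Finset.mem_coe, Finset.mem_product, Finset.mem_Icc, square,
    Set.mem_ofPred_eq, abs_le]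

theorem finite_square (n : ℕ) : (square n).Finite :=
  coe_squareFinset n ▸ Finset.finite_toSet _

theorem ncard_square (n : ℕ) : (square n).ncard = (2 * n + 1) ^ 2 := by
  rw [← coe_squareFinset, Set.ncard_coe_finset, squareFinset, Finset.card_product, Int.card_Icc,
    sq]
  congr 1 <;> omega

theorem ncard_inter_square_le (C : Set (ℤ × ℤ)) (n : ℕ) :
    (C ∩ square n).ncard ≤ (square n).ncard :=
  Set.ncard_le_ncard Set.inter_subset_right (finite_square n)

theorem ratio_le_one (C : Set (ℤ × ℤ)) (n : ℕ) :
    ((C ∩ square n).ncard : ℝ) / (square n).ncard ≤ 1 :=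
  div_le_one_of_le₀ (by exact_mod_cast ncard_inter_square_le C n) (by positivity)

/-- Counting form of the density bound for a set meeting every translate of a finite set `P`. -/
theorem square_ncard_le_mul (C : Set (ℤ × ℤ)) (P : Finset (ℤ × ℤ)) (K : ℕ)
    (hP : (P : Set (ℤ × ℤ)) ⊆ square K) (hC : ∀ u, ∃ p ∈ P, u + p ∈ C) (n : ℕ) :
    (square n).ncard ≤ (C ∩ square (n + K)).ncard * P.card := by
  have hfin : (C ∩ square (n + K)).Finite := (finite_square _).subset Set.inter_subset_right
  rw [Set.ncard_eq_toFinset_card _ hfin, ← Finset.card_product, ← coe_squareFinset,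
    Set.ncard_coe_finset]
  -- The map `(c, p) ↦ c - p` from `(C ∩ square (n + K)) × P` covers `square n`.
  refine le_trans (Finset.card_le_card ?_)
    (Finset.card_image_le (f := fun q : (ℤ × ℤ) × (ℤ × ℤ) => q.1 - q.2))
  intro u hu
  obtain ⟨p, hp, hup⟩ := hC u
  have hu' : u ∈ square n := by rw [← coe_squareFinset]; exact hu
  have hp' : p ∈ square K := hP hp
  simp only [Finset.mem_image, Finset.mem_product, Set.Finite.mem_toFinset]
  refine ⟨(u + p, p), ⟨⟨hup, ?_⟩, hp⟩, by simp⟩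
  obtain ⟨a, b⟩ := hu'
  obtain ⟨c, d⟩ := hp'
  refine ⟨?_, ?_⟩
  · exact (abs_add_le _ _).trans (by push_cast; linarith)
  · exact (abs_add_le _ _).trans (by push_cast; linarith)

open Filter Topology in
theorem tendsto_square_ratio (K : ℕ) :
    Tendsto (fun n : ℕ => ((2 * ((n : ℝ) - K) + 1) / (2 * n + 1)) ^ 2 / 4) atTop
      (𝓝 (1 / 4)) := by
  have h : Tendsto (fun n : ℕ => (1 : ℝ) - 2 * K * (1 / (2 * n + 1))) atTop (𝓝 (1 - 2 * K * 0)) := by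
    refine tendsto_const_nhds.sub (tendsto_const_nhds.mul ?_)
    refine squeeze_zero (fun n => by positivity) (fun n => ?_) tendsto_one_div_add_atTop_nhds_zero_nat
    exact one_div_le_one_div_of_le (by positivity) (by linarith [(Nat.cast_nonneg n : (0 : ℝ) ≤ n)])
  have h' := (h.pow 2).div_const 4
  simp only [mul_zero, sub_zero, one_pow] at h'
  refine h'.congr fun n => ?_
  have : (2 * (n : ℝ) + 1) ≠ 0 := by positivity
  congr 2
  field_simp
  ring

open Filter in
theorem one_fourth_le_density (C : Set (ℤ × ℤ)) (P : Finset (ℤ × ℤ)) (hcard : P.card = 4)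
    (hC : ∀ u, ∃ p ∈ P, u + p ∈ C) : 1 / 4 ≤ density C := by
  obtain ⟨K, hK⟩ : ∃ K : ℕ, (P : Set (ℤ × ℤ)) ⊆ square K := by
    refine ⟨P.sup fun p => p.1.natAbs + p.2.natAbs, fun p hp => ?_⟩
    have h := Finset.le_sup (f := fun p : ℤ × ℤ => p.1.natAbs + p.2.natAbs) hp
    refine ⟨?_, ?_⟩ <;> rw [Int.abs_eq_natAbs] <;> omega
  rw [← (tendsto_square_ratio K).limsup_eq]
  refine limsup_le_limsup ?_ (tendsto_square_ratio K).isCoboundedUnder_le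
    ⟨1, eventually_map.mpr (Eventually.of_forall (ratio_le_one C))⟩
  filter_upwards [eventually_ge_atTop K] with n hn
  obtain ⟨m, rfl⟩ := Nat.exists_eq_add_of_le' hn
  have h := square_ncard_le_mul C P K hK hC m
  rw [ncard_square, hcard] at h
  have h' : (2 * (m : ℝ) + 1) ^ 2 ≤ (C ∩ square (m + K)).ncard * 4 := by exact_mod_cast h
  rw [ncard_square, div_pow, div_right_comm]
  push_cast
  gcongr
  rw [add_sub_cancel_right]
  linarith

theorem one_fourth_le_density_of_isIdentifyingCode {k i : ℤ} {r Δ : ℝ} (hi : Odd i)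
    (hik : i ^ 2 < 2 * k + 1) (hr : r = √((k : ℝ) ^ 2 + (i : ℝ) ^ 2))
    (hΔ : r + Δ = √(r ^ 2 + 2 * (k : ℝ))) {C : Set (ℤ × ℤ)} (hC : IsIdentifyingCode r Δ C) :
    1 / 4 ≤ density C := by
  have hk := one_le_of_odd_of_sq_lt hi hik
  refine one_fourth_le_density C (patternPoints k i) (card_patternPoints hi hk) fun u => ?_
  -- This separating set is the pattern translated by `u`.
  obtain ⟨p, hp, hpC⟩ := hC.2 u (u + (-1, 0)) (by simp [Prod.ext_iff])
  refine ⟨p - u, ?_, by simpa using hpC⟩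
  rw [← Finset.mem_coe, ← horizontalPattern_eq hi hik hr hΔ, horizontalPattern,
    mem_separatingSet_iff hk hr hΔ]
  rw [mem_separatingSet_iff hk hr hΔ] at hp
  have e : p.1 - (u.1 + -1) = p.1 - u.1 - -1 := by ring
  simpa only [Prod.fst_add, Prod.snd_add, Prod.fst_sub, Prod.snd_sub, Prod.fst_zero,
    add_zero, sub_zero, e] using hp

/-! ### Density of the diagonal code -/

theorem card_filter_dvd_le (n : ℕ) (x : ℤ) :
    (((Finset.Icc (-(n : ℤ)) n).filter fun y => 4 ∣ y - x).card : ℝ) ≤ (2 * n + 1) / 4 + 1 := by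
  have h : ((Finset.Icc (-(n : ℤ)) n).filter fun y => 4 ∣ y - x).card ≤
      -- The `+ 3` makes the lower quotient a ceiling.
      (Finset.Icc ((-(n : ℤ) - x + 3) / 4) ((n - x) / 4)).card := by
    refine Finset.card_le_card_of_injOn (fun y => (y - x) / 4) ?_ ?_
    · intro y hy
      simp only [Finset.coe_filter, Finset.mem_Icc, Set.mem_ofPred_eq] at hy
      simp only [Finset.coe_Icc, Set.mem_Icc]
      omega
    · intro y hy z hz hyz
      simp only [Finset.coe_filter, Finset.mem_Icc, Set.mem_ofPred_eq] at hy hz hyz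
      omega
  rw [Int.card_Icc] at h
  have h' : 4 * ((Finset.Icc (-(n : ℤ)) n).filter fun y => 4 ∣ y - x).card ≤ 2 * n + 1 + 4 := by
    omega
  have h'' : (4 : ℝ) * ((Finset.Icc (-(n : ℤ)) n).filter fun y => 4 ∣ y - x).card
      ≤ 2 * n + 1 + 4 := by exact_mod_cast h'
  linarith

theorem ncard_diagonalCode_inter_square_le (n : ℕ) :
    ((diagonalCode ∩ square n).ncard : ℝ) ≤ (2 * n + 1) * ((2 * n + 1) / 4 + 1) := by
  have h : diagonalCode ∩ square n =
      ((Finset.Icc (-(n : ℤ)) n).sigma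
        fun x => (Finset.Icc (-(n : ℤ)) n).filter fun y => 4 ∣ y - x).image
          (fun q => (q.1, q.2)) := by
    ext ⟨x, y⟩
    simp [diagonalCode, square, abs_le]
    tauto
  rw [h, Set.ncard_coe_finset]
  refine (Nat.cast_le.mpr Finset.card_image_le).trans ?_
  rw [Finset.card_sigma, Nat.cast_sum]
  refine (Finset.sum_le_card_nsmul _ _ _ fun x _ => card_filter_dvd_le n x).trans_eq ?_
  rw [Int.card_Icc, nsmul_eq_mul]
  congr 1
  have : ((n : ℤ) + 1 - -n).toNat = 2 * n + 1 := by omega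
  rw [this]
  push_cast
  ring

open Filter Topology in
theorem density_diagonalCode_le : density diagonalCode ≤ 1 / 4 := by
  have hlim : Tendsto (fun n : ℕ => (1 / 4 : ℝ) + 1 / (2 * n + 1)) atTop (𝓝 (1 / 4 + 0)) := by
    refine tendsto_const_nhds.add ?_
    refine squeeze_zero (fun n => by positivity) (fun n => ?_) tendsto_one_div_add_atTop_nhds_zero_nat
    exact one_div_le_one_div_of_le (by positivity) (by linarith [(Nat.cast_nonneg n : (0 : ℝ) ≤ n)])
  rw [add_zero] at hlim
  rw [← hlim.limsup_eq]
  refine limsup_le_limsup (Eventually.of_forall fun n => ?_)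
    (IsCoboundedUnder.of_frequently_ge (a := 0) (Frequently.of_forall fun n => by positivity))
    hlim.isBoundedUnder_le
  have hpos : (0 : ℝ) < 2 * n + 1 := by positivity
  simp only [ncard_square]
  push_cast
  rw [div_le_iff₀ (by positivity)]
  refine (ncard_diagonalCode_inter_square_le n).trans_eq ?_
  field_simp

/-- Converts a lower bound on `r` into one on `k`, so `r₀ = 1001` yields `k ≥ 1000`. -/
theorem radius_le_add_one {k i : ℤ} {r : ℝ} (hk : 1 ≤ k) (hik : i ^ 2 < 2 * k + 1)
    (hr : r = √((k : ℝ) ^ 2 + (i : ℝ) ^ 2)) : r ≤ k + 1 := by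
  have hk' : (1 : ℝ) ≤ k := by exact_mod_cast hk
  have hik' : (i : ℝ) ^ 2 < 2 * k + 1 := by exact_mod_cast hik
  rw [hr, Real.sqrt_le_left (by linarith)]
  linarith

end TolerantCode

theorem mainTheorem3 :
    (∀ (k i : ℤ) (r Δ : ℝ), Odd i → i ^ 2 < 2 * k + 1 →
      r = √((k : ℝ) ^ 2 + (i : ℝ) ^ 2) → r + Δ = √(r ^ 2 + 2 * (k : ℝ)) →
      (TolerantCode.horizontalPattern r Δ).ncard = 4 ∧
        TolerantCode.MeetsAllDiagonals 4 (TolerantCode.horizontalPattern r Δ)) ∧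
    ∃ r₀ : ℝ, ∀ (k i : ℤ) (r Δ : ℝ), Odd i → i ^ 2 < 2 * k + 1 →
      r = √((k : ℝ) ^ 2 + (i : ℝ) ^ 2) → r + Δ = √(r ^ 2 + 2 * (k : ℝ)) → r₀ ≤ r →
      ∃ C : Set (ℤ × ℤ),
        TolerantCode.IsOptimalIdentifyingCode r Δ C ∧ TolerantCode.density C = 1 / 4 := by
  refine ⟨fun k i r Δ hi hik hr hΔ =>
    ⟨TolerantCode.ncard_horizontalPattern hi hik hr hΔ,
      TolerantCode.meetsAllDiagonals_horizontalPattern hi hik hr hΔ⟩,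
    1001, fun k i r Δ hi hik hr hΔ hr₀ => ?_⟩
  have hk : 1000 ≤ k := by
    have h := TolerantCode.radius_le_add_one (TolerantCode.one_le_of_odd_of_sq_lt hi hik) hik hr
    have : (1000 : ℝ) ≤ k := by linarith
    exact_mod_cast this
  have hC := TolerantCode.isIdentifyingCode_diagonalCode hk hi hik hr hΔ
  exact ⟨TolerantCode.diagonalCode,
    ⟨hC, fun C' hC' => TolerantCode.density_diagonalCode_le.trans
      (TolerantCode.one_fourth_le_density_of_isIdentifyingCode hi hik hr hΔ hC')⟩,
    le_antisymm TolerantCode.density_diagonalCode_le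
      (TolerantCode.one_fourth_le_density_of_isIdentifyingCode hi hik hr hΔ hC)⟩
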